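/- Let $\Gamma$ be a group, let $a\in\Gamma$ be an element of infinite order, and let $S\subset\Gamma$ be a finite generating set with $S=S^{-1}$ and $a\in S$. Let $G$ be the Cayley graph with vertex set $\Gamma$ and edge set $E=\{\{g,sg\} : g\in\Gamma,\ s\in S\}$, on which $\Gamma$ acts by right translations, and let $L(a)\subseteq G$ be the subgraph consisting of all edges $\{g,ag\}$, $g\in\Gamma$, i.e. the union of the bi-infinite lines through $\{a^ng : n\in\mathbb Z\}$. Identify the elements of $\{0,1\}^E$ with the spanning subgraphs of $G$, and let $\mu$ be Lebesgue measure on $[0,1]$. Then there is a probability measure $\sigma$ on $\{0,1\}^E$, concentrated on the spanning forests of $G$ (subgraphs without cycles), such that 1. $L(a)$ is contained in the random subforest $\sigma$-almost surely; 2. $\sigma$ is a factor of i.i.d.: it is $\Gamma$-invariant and there is a measurable $\Gamma$-equivariant map $\Phi:[0,1]^E\to\{0,1\}^E$ with $\sigma=\Phi_*(\mu^{\otimes E})$; 3. the expected degree $\deg(\sigma)$ of the vertex $1\in\Gamma$ in the random subforest satisfies $$\deg(\sigma)\ \ge\ 2\cdot\mathrm{cost}\bigl(\Gamma\curvearrowright[0,1]^E\bigr).$$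 Here $[0,1]^E$ carries the product measure $\lambda=\mu^{\otimes E}$ and the $\Gamma$-action induced by that on $E$, and the cost of the action is the infimum of $\frac12\int \deg_{\mathcal G}(x)\,d\lambda(x)$ over all Borel graphs $\mathcal G$ on $[0,1]^E$ whose connected components are exactly the $\Gamma$-orbits. -/

import Mathlib

open MeasureTheory
open scoped ENNReal

noncomputable section

/-! ### Cost of a measured equivalence relation and of an action -/

/-- A graphing of an equivalence relation `r` on `X`: a measurable (simple) graph on `X` whose
connected components are exactly the classes of `r`. -/
structure IsGraphing {X : Type*} [MeasurableSpace X] (r : Setoid X) (G : SimpleGraph X) :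
    Prop where
  measurableSet_adj : MeasurableSet {p : X × X | G.Adj p.1 p.2}
  reachable_iff : ∀ x y : X, G.Reachable x y ↔ r x y

/-- The cost of a graph on a measure space: half of the integral of the degree. -/
def graphCost {X : Type*} [MeasurableSpace X] (μ : Measure X) (G : SimpleGraph X) : ℝ≥0∞ :=
  (∫⁻ x, ((G.neighborSet x).encard : ℝ≥0∞) ∂μ) / 2

/-- The cost of an equivalence relation: the infimum of the costs of its graphings. -/
def relCost {X : Type*} [MeasurableSpace X] (r : Setoid X) (μ : Measure X) : ℝ≥0∞ :=
  ⨅ (G : SimpleGraph X) (_ : IsGraphing r G), graphCost μ G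

/-- The cost of an action of `Γ` on `(X, μ)`: the cost of its orbit equivalence relation. -/
def actionCost (Γ : Type*) {X : Type*} [Group Γ] [MulAction Γ X] [MeasurableSpace X]
    (μ : Measure X) : ℝ≥0∞ :=
  relCost (MulAction.orbitRel Γ X) μ

/-! ### The Cayley graph, its edges, and the action of the group -/

variable {Γ : Type*} [Group Γ]

/-- The (unoriented) edges `{g, s g}` of the Cayley graph of `Γ` with respect to `S`. If `1 ∈ S`
there is a loop at every vertex. -/
def cayleyEdgeSet (S : Finset Γ) : Set (Sym2 Γ) :=
  {e | ∃ g : Γ, ∃ s ∈ S, e = s(g, s * g)}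

/-- The type `E` of edges of the Cayley graph. -/
def CayleyEdge (S : Finset Γ) : Type _ := {e : Sym2 Γ // e ∈ cayleyEdgeSet S}

theorem map_mem_cayleyEdgeSet {S : Finset Γ} (g : Γ) {e : Sym2 Γ} (he : e ∈ cayleyEdgeSet S) :
    Sym2.map (fun h => h * g⁻¹) e ∈ cayleyEdgeSet S := by
  obtain ⟨h, s, hs, rfl⟩ := he
  exact ⟨h * g⁻¹, s, hs, by simp [mul_assoc]⟩

/-- `Γ` acts on the edges by right translation of both endpoints (written as a left action, so
`g` translates by `g⁻¹`). -/
instance CayleyEdge.instMulAction (S : Finset Γ) : MulAction Γ (CayleyEdge S) where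
  smul g e := ⟨Sym2.map (fun h => h * g⁻¹) e.1, map_mem_cayleyEdgeSet g e.2⟩
  one_smul e := by
    apply Subtype.ext
    change Sym2.map (fun h => h * (1 : Γ)⁻¹) e.1 = e.1
    simp
  mul_smul g k e := by
    apply Subtype.ext
    change Sym2.map (fun h => h * (g * k)⁻¹) e.1 =
      Sym2.map (fun h => h * g⁻¹) (Sym2.map (fun h => h * k⁻¹) e.1)
    rw [Sym2.map_map]
    congr 1
    funext h
    simp [mul_assoc]

/-- The space `A ^ E` of labellings of the edges by elements of `A`, with the product
`σ`-algebra. -/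
abbrev EdgeLabelling (S : Finset Γ) (A : Type*) : Type _ := CayleyEdge S → A

/-- The action of `Γ` on labellings induced by the action on edges:
`(g • x) e = x (g⁻¹ • e)`. -/
instance EdgeLabelling.instMulAction (S : Finset Γ) (A : Type*) :
    MulAction Γ (EdgeLabelling S A) :=
  arrowAction

/-- The product of the Lebesgue measures on `[0,1] ^ E`. -/
def iidMeasure (S : Finset Γ) : Measure (EdgeLabelling S unitInterval) :=
  Measure.infinitePi (fun _ : CayleyEdge S => (volume : Measure unitInterval))

/-! ### Spanning subgraphs and random spanning forests -/

/-- A spanning subgraph of the Cayley graph, that is, an element of `{0,1} ^ E`. -/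
abbrev SpanningSubgraph (S : Finset Γ) : Type _ := EdgeLabelling S Bool

/-- The set of edges of a spanning subgraph, as a set of unordered pairs of vertices. -/
def SpanningSubgraph.edges {S : Finset Γ} (x : SpanningSubgraph S) : Set (Sym2 Γ) :=
  {e | ∃ h : e ∈ cayleyEdgeSet S, x ⟨e, h⟩ = true}

/-- A spanning subgraph is a forest if it contains no cycle (loops are cycles of length one). -/
def SpanningSubgraph.IsForest {S : Finset Γ} (x : SpanningSubgraph S) : Prop :=
  (∀ e ∈ SpanningSubgraph.edges x, ¬ e.IsDiag) ∧
    (SimpleGraph.fromEdgeSet (SpanningSubgraph.edges x)).IsAcyclic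

/-- The edges of the union `L(a)` of all the lines `{a ^ n * g | n ∈ ℤ}`, `g ∈ Γ`. -/
def lineEdges (a : Γ) : Set (Sym2 Γ) :=
  {e | ∃ (g : Γ) (n : ℤ), e = s(a ^ n * g, a ^ (n + 1) * g)}

/-- A random spanning subforest: a probability measure on `{0,1} ^ E` that is concentrated on the
(closed) set of forests. -/
structure IsRandomSpanningForest {S : Finset Γ} (σ : Measure (SpanningSubgraph S)) : Prop where
  isProbabilityMeasure : IsProbabilityMeasure σ
  ae_isForest : ∀ᵐ x ∂σ, SpanningSubgraph.IsForest x

/-- `σ` is an invariant factor of i.i.d.: it is `Γ`-invariant, and it is the image of the product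
measure on `[0,1] ^ E` under a measurable `Γ`-equivariant map. -/
structure IsFactorOfIID {S : Finset Γ} (σ : Measure (SpanningSubgraph S)) : Prop where
  invariant : ∀ g : Γ, σ.map (fun x => g • x) = σ
  exists_factor : ∃ Φ : EdgeLabelling S unitInterval → SpanningSubgraph S,
    Measurable Φ ∧ (∀ (g : Γ) (x : EdgeLabelling S unitInterval), Φ (g • x) = g • Φ x) ∧
      σ = (iidMeasure S).map Φ

/-- The expected degree of the vertex `1`: the expected number of edges at `1`. -/
def expectedDegree {S : Finset Γ} (σ : Measure (SpanningSubgraph S)) : ℝ≥0∞ :=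
  ∫⁻ x, (({e ∈ SpanningSubgraph.edges x | (1 : Γ) ∈ e}).encard : ℝ≥0∞) ∂σ

end

noncomputable section

/-! ### Connections by short paths -/

/-! Give the edges i.i.d. uniform labels and take the free minimal spanning forest in which line
edges count as smaller than every label: an edge off the lines is discarded when a finite path of
line edges and edges of smaller label joins its endpoints (`relativeForest`). Equivariance and the
inclusion of the lines are built in. It is a forest because a cycle cannot consist of line edges
alone, `a` having infinite order, and its non-line edge of largest label should have been discarded
(`isForest_relativeForest`).

This forest may be disconnected, so the cost bound is proved for the approximations `truncatedForest
a n`, which discard an edge only when such a path has at most `n` edges. They are almost surely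
connected: replace a discarded edge by its bypass, then the discarded edges of the bypass, and so on
(`reachable_truncatedForest`). The recursion stops because a graph of bounded degree almost surely
has no infinite path of decreasing labels (`ae_wellFounded`). A connected equivariant subgraph
induces a graphing of the orbit relation whose degree at `x` is at most the degree of `1`
(`two_mul_actionCost_le`). The approximations decrease to the forest, and only finitely many edges
meet `1`, so the bound passes to the limit. -/

/-- The vertex `v` is joined to `u` by a path of at most `n` edges that belong to `P`. -/
def WithinDist {V : Type*} (P : Set (Sym2 V)) : ℕ → V → V → Prop
  | 0, u, v => u = v
  | n + 1, u, v => ∃ w, WithinDist P n u w ∧ (w = v ∨ s(w, v) ∈ P)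

namespace WithinDist

variable {V : Type*} {P Q : Set (Sym2 V)}

theorem succ {n : ℕ} {u v : V} (h : WithinDist P n u v) : WithinDist P (n + 1) u v :=
  ⟨v, h, Or.inl rfl⟩

theorem mono_length {m n : ℕ} (hmn : m ≤ n) {u v : V} (h : WithinDist P m u v) :
    WithinDist P n u v := by
  induction hmn with
  | refl => exact h
  | step _ ih => exact ih.succ

theorem reachable_of_forall {G : SimpleGraph V} {n : ℕ} {u v : V} (h : WithinDist P n u v)
    (hP : ∀ y z, s(y, z) ∈ P → G.Reachable y z) : G.Reachable u v := by
  induction n generalizing v with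
  | zero => exact (show u = v from h) ▸ SimpleGraph.Reachable.refl u
  | succ n ih =>
    obtain ⟨w, hw, rfl | hwv⟩ := h
    · exact ih hw
    · exact (ih hw).trans (hP _ _ hwv)

/-- Splitting reachability by length serves twice: it reduces measurability to countable operations,
and it allows bypasses to be truncated at length `n`. -/
theorem exists_iff_reachable {u v : V} :
    (∃ n, WithinDist P n u v) ↔ (SimpleGraph.fromEdgeSet P).Reachable u v := by
  constructor
  · rintro ⟨n, h⟩
    refine h.reachable_of_forall fun y z hyz => ?_
    by_cases hne : y = z
    · exact hne ▸ SimpleGraph.Reachable.refl y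
    · exact SimpleGraph.Adj.reachable ((SimpleGraph.fromEdgeSet_adj P).2 ⟨hyz, hne⟩)
  · intro h
    rw [SimpleGraph.reachable_iff_reflTransGen] at h
    induction h with
    | refl => exact ⟨0, rfl⟩
    | tail _ hbc ih =>
      obtain ⟨n, hn⟩ := ih
      exact ⟨n + 1, _, hn, Or.inr ((SimpleGraph.fromEdgeSet_adj P).1 hbc).1⟩

theorem preimage_iff (f : Equiv.Perm V) {n : ℕ} {u v : V} :
    WithinDist (Sym2.map f ⁻¹' P) n u v ↔ WithinDist P n (f u) (f v) := by
  induction n generalizing v with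
  | zero => exact f.injective.eq_iff.symm
  | succ n ih =>
    constructor
    · rintro ⟨w, hw, h⟩
      exact ⟨f w, ih.1 hw, h.imp (congrArg f) id⟩
    · rintro ⟨w, hw, h⟩
      obtain ⟨w, rfl⟩ := f.surjective w
      exact ⟨w, ih.2 hw, h.imp (fun h => f.injective h) id⟩

theorem measurableSet {X : Type*} [MeasurableSpace X] [Countable V] {P : X → Set (Sym2 V)}
    (hP : ∀ e, MeasurableSet {x | e ∈ P x}) (n : ℕ) (u v : V) :
    MeasurableSet {x | WithinDist (P x) n u v} := by
  induction n generalizing v with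
  | zero => exact MeasurableSet.const _
  | succ n ih =>
    have : {x | WithinDist (P x) (n + 1) u v} =
        ⋃ w, {x | WithinDist (P x) n u w} ∩ ({_x | w = v} ∪ {x | s(w, v) ∈ P x}) := by
      ext x
      simp [WithinDist]
    rw [this]
    exact MeasurableSet.iUnion fun w => (ih w).inter ((MeasurableSet.const _).union (hP _))

end WithinDist

/-- A set of edges contains no cycle if and only if no edge of it has endpoints that are joined by
the other edges. -/
theorem isAcyclic_fromEdgeSet_iff {V : Type*} {P : Set (Sym2 V)} :
    ((∀ e ∈ P, ¬ e.IsDiag) ∧ (SimpleGraph.fromEdgeSet P).IsAcyclic) ↔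
      ∀ u v, s(u, v) ∈ P → ∀ n, ¬ WithinDist (P \ {s(u, v)}) n u v := by
  have key : ∀ u v, (SimpleGraph.fromEdgeSet P).deleteEdges {s(u, v)} =
      SimpleGraph.fromEdgeSet (P \ {s(u, v)}) := by
    intro u v
    ext y z
    simp only [SimpleGraph.deleteEdges_adj, SimpleGraph.fromEdgeSet_adj, Set.mem_sdiff]
    tauto
  constructor
  · rintro ⟨hd, hac⟩ u v huv n h
    have hne : u ≠ v := fun h => hd _ huv (by simp [h])
    have hb := SimpleGraph.isAcyclic_iff_forall_adj_isBridge.1 hac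
      ((SimpleGraph.fromEdgeSet_adj P).2 ⟨huv, hne⟩)
    rw [SimpleGraph.isBridge_iff, key] at hb
    exact hb (WithinDist.exists_iff_reachable.1 ⟨n, h⟩)
  · intro h
    refine ⟨fun e he hdiag => ?_, ?_⟩
    · induction e using Sym2.ind with
      | _ u v => exact h u v he 0 (show u = v by simpa using hdiag)
    · rw [SimpleGraph.isAcyclic_iff_forall_adj_isBridge]
      intro u v huv
      rw [SimpleGraph.isBridge_iff, key, ← WithinDist.exists_iff_reachable]
      rintro ⟨n, hn⟩
      exact h u v ((SimpleGraph.fromEdgeSet_adj P).1 huv).1 n hn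

variable {Γ : Type*} [Group Γ]

/-! ### The lines -/

theorem mem_lineEdges_iff {a : Γ} {e : Sym2 Γ} : e ∈ lineEdges a ↔ ∃ g, e = s(g, a * g) := by
  constructor
  · rintro ⟨g, n, rfl⟩
    exact ⟨a ^ n * g, by rw [zpow_add_one, ← mul_assoc, (Commute.self_zpow a n).eq]⟩
  · rintro ⟨g, rfl⟩
    exact ⟨g, 0, by simp⟩

theorem lineEdges_subset_cayleyEdgeSet {a : Γ} {S : Finset Γ} (haS : a ∈ S) :
    lineEdges a ⊆ cayleyEdgeSet S := by
  intro e he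
  obtain ⟨g, rfl⟩ := mem_lineEdges_iff.1 he
  exact ⟨g, a, haS, rfl⟩

theorem map_mem_lineEdges_iff {a : Γ} (g : Γ) {e : Sym2 Γ} :
    Sym2.map (Equiv.mulRight g) e ∈ lineEdges a ↔ e ∈ lineEdges a := by
  simp only [mem_lineEdges_iff]
  constructor
  · rintro ⟨h, he⟩
    refine ⟨h * g⁻¹, Sym2.map.injective (Equiv.mulRight g).injective ?_⟩
    rw [he]
    simp [mul_assoc]
  · rintro ⟨h, rfl⟩
    exact ⟨h * g, by simp [mul_assoc]⟩

theorem map_mem_cayleyEdgeSet_iff {S : Finset Γ} (g : Γ) {e : Sym2 Γ} :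
    Sym2.map (Equiv.mulRight g) e ∈ cayleyEdgeSet S ↔ e ∈ cayleyEdgeSet S := by
  constructor
  · intro h
    have := map_mem_cayleyEdgeSet g h
    rw [Sym2.map_map] at this
    convert this
    rw [show ((fun h => h * g⁻¹) ∘ (Equiv.mulRight g)) = id by ext; simp]
    simp
  · intro h
    simpa using map_mem_cayleyEdgeSet g⁻¹ h

/-- The lines of an element of infinite order form a forest. -/
theorem isAcyclic_lineEdges {a : Γ} (ha : ¬ IsOfFinOrder a) :
    (SimpleGraph.fromEdgeSet (lineEdges a)).IsAcyclic := by
  refine (isAcyclic_fromEdgeSet_iff.2 ?_).2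
  -- Without the edge from `g` to `a * g`, a path from `g` never leaves the backward half-line: a
  -- forward step from `g` itself would use the deleted edge. Reaching `a * g` would then give `a ^
  -- (m + 1) = 1`.
  have key : ∀ (g : Γ) n k, WithinDist (lineEdges a \ {s(g, a * g)}) n g k →
      ∃ m : ℕ, k = (a ^ m)⁻¹ * g := by
    intro g n
    induction n with
    | zero => rintro k h; exact ⟨0, by simpa using (show g = k from h).symm⟩
    | succ n ih =>
      rintro k ⟨w, hw, rfl | ⟨hwk, hne⟩⟩
      · exact ih w hw
      · obtain ⟨m, rfl⟩ := ih w hw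
        obtain ⟨h, hh⟩ := mem_lineEdges_iff.1 hwk
        rcases Sym2.eq_iff.1 hh with ⟨h1, h2⟩ | ⟨h1, h2⟩
        · subst h2
          rw [← h1]
          cases m with
          | zero => exact absurd (by rw [← h1]; simp) hne
          | succ m => exact ⟨m, by rw [pow_succ']; group⟩
        · subst h2
          refine ⟨m + 1, ?_⟩
          rw [pow_succ, mul_inv_rev, mul_assoc, h1]
          group
  have hno : ∀ (g : Γ) n, ¬ WithinDist (lineEdges a \ {s(g, a * g)}) n g (a * g) := by
    intro g n h
    obtain ⟨m, hm⟩ := key g n _ h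
    refine ha (isOfFinOrder_iff_pow_eq_one.2 ⟨m + 1, m.succ_pos, ?_⟩)
    rw [pow_succ']
    nth_rewrite 1 [mul_right_cancel hm]
    exact inv_mul_cancel _
  intro u v huv n h
  obtain ⟨g, hg⟩ := mem_lineEdges_iff.1 huv
  have h' : (SimpleGraph.fromEdgeSet (lineEdges a \ {s(g, a * g)})).Reachable g (a * g) := by
    rw [hg] at h
    have := WithinDist.exists_iff_reachable.1 ⟨n, h⟩
    rcases Sym2.eq_iff.1 hg with ⟨rfl, rfl⟩ | ⟨rfl, rfl⟩
    · exact this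
    · exact this.symm
  obtain ⟨n, hn⟩ := WithinDist.exists_iff_reachable.2 h'
  exact hno g n hn

/-! ### The minimal spanning forest relative to the lines -/

variable {S : Finset Γ}

theorem CayleyEdge.coe_inv_smul (g : Γ) (e : CayleyEdge S) :
    (g⁻¹ • e).1 = Sym2.map (Equiv.mulRight g) e.1 := by
  change Sym2.map (fun h => h * g⁻¹⁻¹) e.1 = _
  rw [inv_inv]
  rfl

theorem EdgeLabelling.smul_apply {A : Type*} (g : Γ) (x : EdgeLabelling S A) (e : CayleyEdge S) :
    (g • x) e = x (g⁻¹ • e) := rfl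

theorem EdgeLabelling.apply_map {A : Type*} (g : Γ) (x : EdgeLabelling S A) {e : Sym2 Γ}
    (h : e ∈ cayleyEdgeSet S) :
    (g • x) ⟨e, h⟩ = x ⟨Sym2.map (Equiv.mulRight g) e, (map_mem_cayleyEdgeSet_iff g).2 h⟩ :=
  congrArg x (Subtype.ext (CayleyEdge.coe_inv_smul g ⟨e, h⟩))

theorem SpanningSubgraph.edges_smul (g : Γ) (y : SpanningSubgraph S) :
    SpanningSubgraph.edges (g • y) =
      Sym2.map (Equiv.mulRight g) ⁻¹' SpanningSubgraph.edges y := by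
  ext e
  constructor
  · rintro ⟨h, hy⟩
    exact ⟨(map_mem_cayleyEdgeSet_iff g).2 h, (EdgeLabelling.apply_map g y h).symm.trans hy⟩
  · rintro ⟨h, hy⟩
    have h' := (map_mem_cayleyEdgeSet_iff g).1 h
    exact ⟨h', (EdgeLabelling.apply_map g y h').trans hy⟩

theorem SpanningSubgraph.coe_mem_edges_iff {y : SpanningSubgraph S} {e : CayleyEdge S} :
    e.1 ∈ SpanningSubgraph.edges y ↔ y e = true :=
  ⟨fun ⟨_, h⟩ => h, fun h => ⟨e.2, h⟩⟩

/-- The edges of the lines, and the edges whose label is less than `t`. -/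
def lowerEdges (a : Γ) (x : EdgeLabelling S unitInterval) (t : unitInterval) : Set (Sym2 Γ) :=
  {f | f ∈ lineEdges a ∨ ∃ h : f ∈ cayleyEdgeSet S, x ⟨f, h⟩ < t}

/-- An edge outside the lines is redundant at scale `n` if its endpoints are joined by a path of
at most `n` edges that belong to the lines or have smaller labels. -/
def IsRedundant (a : Γ) (n : ℕ) (x : EdgeLabelling S unitInterval) (e : CayleyEdge S) : Prop :=
  e.1 ∉ lineEdges a ∧ ∃ u v, e.1 = s(u, v) ∧ WithinDist (lowerEdges a x (x e)) n u v

open Classical in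
/-- The subgraph of all edges that are not redundant at scale `n`. -/
def truncatedForest (a : Γ) (n : ℕ) (x : EdgeLabelling S unitInterval) : SpanningSubgraph S :=
  fun e => decide (¬ IsRedundant a n x e)

open Classical in
/-- The free minimal spanning forest relative to the lines: the subgraph of all edges that are not
redundant at any scale. -/
def relativeForest (a : Γ) (x : EdgeLabelling S unitInterval) : SpanningSubgraph S :=
  fun e => decide (∀ n, ¬ IsRedundant a n x e)

theorem truncatedForest_eq_true_iff {a : Γ} {n : ℕ} {x : EdgeLabelling S unitInterval}
    {e : CayleyEdge S} : truncatedForest a n x e = true ↔ ¬ IsRedundant a n x e := by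
  classical
  exact decide_eq_true_iff

theorem relativeForest_eq_true_iff {a : Γ} {x : EdgeLabelling S unitInterval}
    {e : CayleyEdge S} : relativeForest a x e = true ↔ ∀ n, ¬ IsRedundant a n x e := by
  classical
  exact decide_eq_true_iff

theorem IsRedundant.mono {a : Γ} {m n : ℕ} (hmn : m ≤ n) {x : EdgeLabelling S unitInterval}
    {e : CayleyEdge S} (h : IsRedundant a m x e) : IsRedundant a n x e := by
  obtain ⟨he, u, v, huv, hw⟩ := h
  exact ⟨he, u, v, huv, hw.mono_length hmn⟩

theorem lowerEdges_smul (a g : Γ) (x : EdgeLabelling S unitInterval) (t : unitInterval) :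
    lowerEdges a (g • x) t = Sym2.map (Equiv.mulRight g) ⁻¹' lowerEdges a x t := by
  ext f
  simp only [lowerEdges, Set.mem_preimage, Set.mem_ofPred_eq, map_mem_lineEdges_iff]
  refine or_congr Iff.rfl ⟨?_, ?_⟩
  · rintro ⟨h, hlt⟩
    exact ⟨(map_mem_cayleyEdgeSet_iff g).2 h,
      lt_of_eq_of_lt (EdgeLabelling.apply_map g x h).symm hlt⟩
  · rintro ⟨h, hlt⟩
    have h' := (map_mem_cayleyEdgeSet_iff g).1 h
    exact ⟨h', lt_of_eq_of_lt (EdgeLabelling.apply_map g x h') hlt⟩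

theorem isRedundant_smul_iff (a : Γ) (n : ℕ) (g : Γ) (x : EdgeLabelling S unitInterval)
    (e : CayleyEdge S) : IsRedundant a n (g • x) e ↔ IsRedundant a n x (g⁻¹ • e) := by
  unfold IsRedundant
  rw [CayleyEdge.coe_inv_smul, map_mem_lineEdges_iff, EdgeLabelling.smul_apply, lowerEdges_smul]
  refine and_congr Iff.rfl ⟨?_, ?_⟩
  · rintro ⟨u, v, he, h⟩
    exact ⟨_, _, by rw [he, Sym2.map_mk], (WithinDist.preimage_iff _).1 h⟩
  · rintro ⟨u, v, he, h⟩
    obtain ⟨u, rfl⟩ := (Equiv.mulRight g).surjective u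
    obtain ⟨v, rfl⟩ := (Equiv.mulRight g).surjective v
    exact ⟨u, v, Sym2.map.injective (Equiv.mulRight g).injective (by rw [he, Sym2.map_mk]),
      (WithinDist.preimage_iff _).2 h⟩

theorem truncatedForest_smul (a : Γ) (n : ℕ) (g : Γ) (x : EdgeLabelling S unitInterval) :
    truncatedForest a n (g • x) = g • truncatedForest a n x := by
  funext e
  rw [EdgeLabelling.smul_apply, Bool.eq_iff_iff, truncatedForest_eq_true_iff,
    truncatedForest_eq_true_iff, isRedundant_smul_iff]

theorem relativeForest_smul (a g : Γ) (x : EdgeLabelling S unitInterval) :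
    relativeForest a (g • x) = g • relativeForest a x := by
  funext e
  rw [EdgeLabelling.smul_apply, Bool.eq_iff_iff, relativeForest_eq_true_iff,
    relativeForest_eq_true_iff]
  simp_rw [isRedundant_smul_iff]

theorem lineEdges_subset_truncatedForest {a : Γ} (haS : a ∈ S) (n : ℕ)
    (x : EdgeLabelling S unitInterval) :
    lineEdges a ⊆ SpanningSubgraph.edges (truncatedForest a n x) := by
  intro e he
  exact ⟨lineEdges_subset_cayleyEdgeSet haS he, truncatedForest_eq_true_iff.2 fun h => h.1 he⟩

theorem lineEdges_subset_relativeForest {a : Γ} (haS : a ∈ S)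
    (x : EdgeLabelling S unitInterval) :
    lineEdges a ⊆ SpanningSubgraph.edges (relativeForest a x) := by
  intro e he
  exact ⟨lineEdges_subset_cayleyEdgeSet haS he, relativeForest_eq_true_iff.2 fun _ h => h.1 he⟩

/-- The cycle rule: the rest of the cycle bypasses its non-line edge of largest label. Injectivity
of the labels makes that maximum strict. The bypass can have any length, so all scales are needed.
-/
theorem isForest_relativeForest {a : Γ} (ha : ¬ IsOfFinOrder a)
    {x : EdgeLabelling S unitInterval} (hx : Function.Injective x) :
    SpanningSubgraph.IsForest (relativeForest a x) := by
  classical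
  have hF : ∀ e : CayleyEdge S, e.1 ∈ SpanningSubgraph.edges (relativeForest a x) →
      ∀ n, ¬ IsRedundant a n x e := by
    intro e he
    exact relativeForest_eq_true_iff.1 (SpanningSubgraph.coe_mem_edges_iff.1 he)
  refine ⟨fun e he hdiag => ?_, fun v c hc => ?_⟩
  · obtain ⟨hE, h⟩ := he
    have := hF ⟨e, hE⟩ ⟨hE, h⟩ 0
    by_cases hl : e ∈ lineEdges a
    · obtain ⟨g, rfl⟩ := mem_lineEdges_iff.1 hl
      have h1 : a = 1 := by simpa using hdiag
      exact ha (h1 ▸ IsOfFinOrder.one)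
    · induction e using Sym2.ind with
      | _ u v => exact this ⟨hl, u, v, rfl, show u = v by simpa using hdiag⟩
  · have hcE : ∀ e ∈ c.edges, e ∈ SpanningSubgraph.edges (relativeForest a x) := by
      intro e he
      have := c.edges_subset_edgeSet he
      rw [SimpleGraph.edgeSet_fromEdgeSet] at this
      exact this.1
    have hfin : {e : CayleyEdge S | e.1 ∈ c.edges ∧ e.1 ∉ lineEdges a}.Finite :=
      ((List.finite_toSet c.edges).preimage (Subtype.val_injective.injOn)).subset
        fun e he => he.1
    obtain ⟨T, hmemT⟩ : ∃ T : Finset (CayleyEdge S),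
        ∀ e, e ∈ T ↔ e.1 ∈ c.edges ∧ e.1 ∉ lineEdges a :=
      ⟨hfin.toFinset, fun e => hfin.mem_toFinset⟩
    rcases T.eq_empty_or_nonempty with hemp | hne
    · have hl : ∀ e ∈ c.edges, e ∈ lineEdges a := by
        intro e he
        by_contra hl
        obtain ⟨hE, _⟩ := hcE e he
        have : (⟨e, hE⟩ : CayleyEdge S) ∈ T := (hmemT _).2 ⟨he, hl⟩
        rw [hemp] at this
        exact absurd this (Finset.notMem_empty _)
      have hl' : ∀ e ∈ c.edges, e ∈ (SimpleGraph.fromEdgeSet (lineEdges a)).edgeSet := by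
        intro e he
        have := c.edges_subset_edgeSet he
        rw [SimpleGraph.edgeSet_fromEdgeSet] at this ⊢
        exact ⟨hl e he, this.2⟩
      exact isAcyclic_lineEdges ha (c.transfer _ hl') (hc.transfer hl')
    · obtain ⟨e, heT, hmax⟩ := T.exists_max_image x hne
      obtain ⟨hec, hel⟩ := (hmemT e).1 heT
      obtain ⟨u, w, huw⟩ : ∃ u w, e.1 = s(u, w) := by
        induction h : e.1 using Sym2.ind with
        | _ u w => exact ⟨u, w, rfl⟩
      -- Viewing the cycle in the graph of its own edges ensures that the path left after deleting
      -- `e` uses cycle edges only.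
      have hc' : ∀ f ∈ c.edges,
          f ∈ (SimpleGraph.fromEdgeSet {f | f ∈ c.edges}).edgeSet := by
        intro f hf
        have := c.edges_subset_edgeSet hf
        rw [SimpleGraph.edgeSet_fromEdgeSet] at this ⊢
        exact ⟨hf, this.2⟩
      have hr := (SimpleGraph.adj_and_reachable_delete_edges_iff_exists_cycle
        (v := u) (w := w)).2 ⟨_, c.transfer _ hc', hc.transfer hc', by
          rw [SimpleGraph.Walk.edges_transfer, ← huw]; exact hec⟩
      have hle : (SimpleGraph.fromEdgeSet {f | f ∈ c.edges}).deleteEdges {s(u, w)} ≤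
          SimpleGraph.fromEdgeSet (lowerEdges a x (x e)) := by
        intro y z hyz
        rw [SimpleGraph.deleteEdges_adj, SimpleGraph.fromEdgeSet_adj] at hyz
        obtain ⟨⟨hyz, hne⟩, hnot⟩ := hyz
        refine (SimpleGraph.fromEdgeSet_adj _).2 ⟨?_, hne⟩
        by_cases hl : s(y, z) ∈ lineEdges a
        · exact Or.inl hl
        · obtain ⟨hE, _⟩ := hcE _ hyz
          refine Or.inr ⟨hE, lt_of_le_of_ne (hmax _ ((hmemT _).2 ⟨hyz, hl⟩)) fun heq => hnot ?_⟩
          have := congrArg Subtype.val (hx heq)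
          rw [Set.mem_singleton_iff, ← huw, ← this]
      obtain ⟨n, hn⟩ := WithinDist.exists_iff_reachable.2 (hr.2.mono hle)
      exact hF e (hcE _ hec) n ⟨hel, u, w, huw, hn⟩

/-! ### Connectedness of the truncated forests -/

open Classical in
/-- The products of at most `n` elements of `S`. -/
def wordBall (S : Finset Γ) : ℕ → Finset Γ
  | 0 => {1}
  | n + 1 => Finset.image₂ (fun s b => s * b) (insert 1 S) (wordBall S n)

theorem mul_mem_wordBall {n : ℕ} {s b : Γ} (hs : s ∈ S) (hb : b ∈ wordBall S n) :
    s * b ∈ wordBall S (n + 1) := by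
  classical
  exact Finset.mem_image₂_of_mem (Finset.mem_insert_of_mem hs) hb

theorem wordBall_subset_succ (n : ℕ) : wordBall S n ⊆ wordBall S (n + 1) := by
  classical
  intro b hb
  have := Finset.mem_image₂_of_mem (f := fun s b : Γ => s * b) (Finset.mem_insert_self 1 S) hb
  simpa [wordBall] using this

theorem wordBall_mono {m n : ℕ} (h : m ≤ n) : wordBall S m ⊆ wordBall S n :=
  monotone_nat_of_le_succ wordBall_subset_succ h

/-- Balls grow by factors on the left; a factor on the right accounts for a change of starting
vertex, as in `mem_nearEdges`. -/
theorem mul_mem_wordBall_of_mem {n : ℕ} {s b : Γ} (hb : b ∈ wordBall S n) (hs : s ∈ S) :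
    b * s ∈ wordBall S (n + 1) := by
  classical
  induction n generalizing b with
  | zero =>
    obtain rfl : b = 1 := by simpa [wordBall] using hb
    simpa using mul_mem_wordBall hs hb
  | succ n ih =>
    obtain ⟨t, ht, c, hc, rfl⟩ := Finset.mem_image₂.1 hb
    rw [mul_assoc]
    exact Finset.mem_image₂_of_mem ht (ih hc)

theorem eq_mul_of_mem_cayleyEdgeSet (hS : ∀ s ∈ S, s⁻¹ ∈ S) {u v : Γ}
    (h : s(u, v) ∈ cayleyEdgeSet S) : ∃ s ∈ S, v = s * u := by
  obtain ⟨g, s, hs, he⟩ := h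
  rcases Sym2.eq_iff.1 he with ⟨rfl, rfl⟩ | ⟨rfl, rfl⟩
  · exact ⟨s, hs, rfl⟩
  · exact ⟨s⁻¹, hS s hs, by simp⟩

theorem WithinDist.exists_mem_wordBall (hS : ∀ s ∈ S, s⁻¹ ∈ S) {P : Set (Sym2 Γ)}
    (hP : P ⊆ cayleyEdgeSet S) {n : ℕ} {u v : Γ} (h : WithinDist P n u v) :
    ∃ b ∈ wordBall S n, v = b * u := by
  induction n generalizing v with
  | zero => exact ⟨1, by simp [wordBall], by simpa using (show u = v from h).symm⟩
  | succ n ih =>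
    obtain ⟨w, hw, rfl | hwv⟩ := h
    · obtain ⟨b, hb, rfl⟩ := ih hw
      exact ⟨b, wordBall_subset_succ n hb, rfl⟩
    · obtain ⟨b, hb, rfl⟩ := ih hw
      obtain ⟨s, hs, rfl⟩ := eq_mul_of_mem_cayleyEdgeSet hS (hP hwv)
      exact ⟨s * b, mul_mem_wordBall hs hb, (mul_assoc _ _ _).symm⟩

/-- An endpoint of an edge. -/
def CayleyEdge.base (e : CayleyEdge S) : Γ := e.2.choose

open Classical in
/-- A finite set of edges that contains all edges on paths of length `n` from an endpoint
of `e`. -/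
def nearEdges (n : ℕ) (e : CayleyEdge S) : Finset (CayleyEdge S) :=
  Finset.image (fun p : Γ × S => (⟨s(p.1 * e.base, p.2.1 * (p.1 * e.base)),
    p.1 * e.base, p.2.1, p.2.2, rfl⟩ : CayleyEdge S)) (wordBall S (n + 1) ×ˢ Finset.univ)

theorem card_nearEdges_le (n : ℕ) (e : CayleyEdge S) :
    (nearEdges n e).card ≤ (wordBall S (n + 1)).card * S.card := by
  classical
  refine Finset.card_image_le.trans (le_of_eq ?_)
  rw [Finset.card_product, Finset.card_univ, Fintype.card_coe]

theorem mem_nearEdges (hS : ∀ s ∈ S, s⁻¹ ∈ S) {n : ℕ} {e f : CayleyEdge S} {u v w y b : Γ}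
    (he : e.1 = s(u, v)) (hb : b ∈ wordBall S n) (hw : w = b * u) (hf : f.1 = s(w, y)) :
    f ∈ nearEdges n e := by
  classical
  obtain ⟨t, ht, hy⟩ := eq_mul_of_mem_cayleyEdgeSet hS (hf ▸ f.2)
  obtain ⟨s, hs, hbase⟩ : ∃ s ∈ S, e.1 = s(e.base, s * e.base) := e.2.choose_spec
  -- The path may start at the endpoint of `e` other than `e.base`, which costs one more generator;
  -- hence the radius `n + 1`.
  obtain ⟨c, hc, hu⟩ : ∃ c ∈ wordBall S (n + 1), b * u = c * e.base := by
    rcases Sym2.eq_iff.1 (he.symm.trans hbase) with ⟨h, -⟩ | ⟨h, -⟩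
    · exact ⟨b, wordBall_subset_succ n hb, by rw [h]⟩
    · exact ⟨b * s, mul_mem_wordBall_of_mem hb hs, by rw [h, mul_assoc]⟩
  refine Finset.mem_image.2 ⟨(c, ⟨t, ht⟩), Finset.mem_product.2 ⟨hc, Finset.mem_univ _⟩, ?_⟩
  refine Subtype.ext ?_
  change s(c * e.base, t * (c * e.base)) = f.1
  rw [hf, hy, hw, hu]

/-- Well-founded induction on the edge: a discarded edge has a bypass whose edges are line edges,
which are kept, or edges of smaller label in `nearEdges n e`. The bound `n` on the bypass keeps
these neighborhoods finite, of uniformly bounded size. -/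
theorem reachable_truncatedForest {a : Γ} (haS : a ∈ S) (hS : ∀ s ∈ S, s⁻¹ ∈ S) {n : ℕ}
    {x : EdgeLabelling S unitInterval}
    (hwf : WellFounded fun f e : CayleyEdge S => x f < x e ∧ f ∈ nearEdges n e)
    (e : CayleyEdge S) (u v : Γ) (he : e.1 = s(u, v)) :
    (SimpleGraph.fromEdgeSet (SpanningSubgraph.edges (truncatedForest a n x))).Reachable u v := by
  induction e using hwf.induction generalizing u v with
  | _ e ih =>
  by_cases hmem : e.1 ∈ SpanningSubgraph.edges (truncatedForest a n x)
  · rw [he] at hmem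
    exact WithinDist.exists_iff_reachable.1 ⟨1, u, rfl, Or.inr hmem⟩
  · rw [SpanningSubgraph.coe_mem_edges_iff] at hmem
    have hred : IsRedundant a n x e := by
      by_contra h
      exact hmem (truncatedForest_eq_true_iff.2 h)
    obtain ⟨-, u', v', he', hd⟩ := hred
    -- Induction over initial segments of the bypass, since the segment already walked is what
    -- places the next edge in `nearEdges n e`.
    have key : ∀ m ≤ n, ∀ w, WithinDist (lowerEdges a x (x e)) m u' w →
        (SimpleGraph.fromEdgeSet (SpanningSubgraph.edges
          (truncatedForest a n x))).Reachable u' w := by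
      intro m
      induction m with
      | zero => rintro - w h; exact (show u' = w from h) ▸ SimpleGraph.Reachable.refl _
      | succ m ihm =>
        rintro hm y ⟨w, hw, rfl | hwy⟩
        · exact ihm (Nat.le_of_succ_le hm) _ hw
        · refine (ihm (Nat.le_of_succ_le hm) _ hw).trans ?_
          rcases hwy with hl | ⟨hE, hlt⟩
          · exact WithinDist.exists_iff_reachable.1
              ⟨1, w, rfl, Or.inr (lineEdges_subset_truncatedForest haS n x hl)⟩
          · have hsub : lowerEdges a x (x e) ⊆ cayleyEdgeSet S := by
              rintro f (hf | ⟨hf, -⟩)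
              · exact lineEdges_subset_cayleyEdgeSet haS hf
              · exact hf
            obtain ⟨b, hb, hwb⟩ := hw.exists_mem_wordBall hS hsub
            exact ih ⟨s(w, y), hE⟩ ⟨hlt, mem_nearEdges hS he'
              (wordBall_mono (Nat.le_of_succ_le hm) hb) hwb rfl⟩ w y rfl
    have := key n le_rfl v' hd
    rcases Sym2.eq_iff.1 (he.symm.trans he') with ⟨rfl, rfl⟩ | ⟨rfl, rfl⟩
    · exact this
    · exact this.symm

theorem preconnected_of_forall_reachable (hgen : Subgroup.closure (S : Set Γ) = ⊤)
    {G : SimpleGraph Γ} (h : ∀ s ∈ S, ∀ u, G.Reachable u (s * u)) : G.Preconnected := by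
  have key : ∀ g u : Γ, G.Reachable u (g * u) := by
    intro g
    have hg : g ∈ Subgroup.closure (S : Set Γ) := hgen ▸ Subgroup.mem_top g
    induction hg using Subgroup.closure_induction with
    | mem s hs => exact h s hs
    | one => intro u; rw [one_mul]
    | mul g h _ _ ihg ihh =>
      intro u
      rw [mul_assoc]
      exact (ihh u).trans (ihg _)
    | inv g _ ih =>
      intro u
      simpa using (ih (g⁻¹ * u)).symm
  intro u v
  simpa using key (v * u⁻¹) u

theorem preconnected_truncatedForest {a : Γ} (haS : a ∈ S) (hS : ∀ s ∈ S, s⁻¹ ∈ S)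
    (hgen : Subgroup.closure (S : Set Γ) = ⊤) {n : ℕ} {x : EdgeLabelling S unitInterval}
    (hwf : WellFounded fun f e : CayleyEdge S => x f < x e ∧ f ∈ nearEdges n e) :
    (SimpleGraph.fromEdgeSet
      (SpanningSubgraph.edges (truncatedForest a n x))).Preconnected :=
  preconnected_of_forall_reachable hgen fun s hs u =>
    reachable_truncatedForest haS hS hwf ⟨s(u, s * u), u, s, hs, rfl⟩ u _ rfl

/-! ### Independent uniform labels -/

theorem countable_of_closure_eq_top {Γ : Type*} [Group Γ] {S : Finset Γ}
    (hgen : Subgroup.closure (S : Set Γ) = ⊤) : Countable Γ :=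
  (FreeGroup.lift_surjective_iff_closure_range_eq_top (f := ((↑) : S → Γ)).2
    (by rw [← hgen]; congr 1; exact Subtype.range_coe)).countable

/-- The set of labels `t` such that `M * t` has integer part `j`. -/
def labelBox (M j : ℕ) : Set unitInterval := {t | ⌊(M : ℝ) * t⌋₊ = j}

theorem measurableSet_labelBox (M j : ℕ) : MeasurableSet (labelBox M j) := by
  have : Measurable fun t : unitInterval => ⌊(M : ℝ) * t⌋₊ :=
    Nat.measurable_floor.comp (measurable_const.mul measurable_subtype_coe)
  exact this (measurableSet_singleton j)

theorem volume_labelBox_le {M : ℕ} (hM : 0 < M) (j : ℕ) :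
    volume (labelBox M j) ≤ (M : ℝ≥0∞)⁻¹ := by
  have hM' : (0 : ℝ) < M := by exact_mod_cast hM
  rw [unitInterval.volume_apply]
  have hsub : Subtype.val '' labelBox M j ⊆ Set.Icc ((j : ℝ) / M) ((j : ℝ) / M + (M : ℝ)⁻¹) := by
    rintro _ ⟨t, ht, rfl⟩
    have h0 : (0 : ℝ) ≤ M * t := mul_nonneg hM'.le t.2.1
    have h1 := Nat.floor_le h0
    have h2 := Nat.lt_floor_add_one ((M : ℝ) * t)
    rw [show ⌊(M : ℝ) * t⌋₊ = j from ht] at h1 h2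
    constructor
    · rw [div_le_iff₀ hM']
      linarith
    · rw [div_add' _ _ _ hM'.ne', inv_mul_cancel₀ hM'.ne', le_div_iff₀ hM']
      linarith
  refine (measure_mono hsub).trans ?_
  rw [Real.volume_Icc, add_sub_cancel_left, ENNReal.ofReal_inv_of_pos hM', ENNReal.ofReal_natCast]

theorem mem_labelBox_le {M j : ℕ} {t : unitInterval} (h : t ∈ labelBox M j) : j ≤ M := by
  rw [← show ⌊(M : ℝ) * t⌋₊ = j from h]
  refine Nat.floor_le_of_le ?_
  exact mul_le_of_le_one_right (Nat.cast_nonneg M) t.2.2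

theorem infinitePi_labelBox_le {E : Type*} {M : ℕ} (hM : 0 < M) (j : ℕ) (T : Finset E) :
    Measure.infinitePi (fun _ : E => (volume : Measure unitInterval))
      {x | ∀ e ∈ T, x e ∈ labelBox M j} ≤ (M : ℝ≥0∞)⁻¹ ^ T.card := by
  have : {x : E → unitInterval | ∀ e ∈ T, x e ∈ labelBox M j} =
      Set.pi (T : Set E) (fun _ => labelBox M j) := by
    ext x
    simp [Set.mem_pi]
  rw [this, Measure.infinitePi_pi _ fun _ _ => measurableSet_labelBox M j]
  exact Finset.prod_le_pow_card _ _ _ fun _ _ => volume_labelBox_le hM j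

/-- Independent uniform labels are pairwise distinct. -/
theorem ae_injective_infinitePi {E : Type*} [Countable E] :
    ∀ᵐ x ∂Measure.infinitePi (fun _ : E => (volume : Measure unitInterval)),
      Function.Injective x := by
  classical
  have key : ∀ e f : E, e ≠ f →
      ∀ᵐ x ∂Measure.infinitePi (fun _ : E => (volume : Measure unitInterval)), x e ≠ x f := by
    intro e f hef
    -- Equal labels share a box. There are `n + 2` boxes of width `1 / (n + 1)`, the last one only
    -- for the label `1`, and each holds both labels with probability at most `(n + 1)⁻²`.
    have hbound : ∀ n : ℕ, Measure.infinitePi (fun _ : E => (volume : Measure unitInterval))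
        {x | ¬ x e ≠ x f} ≤ 2 * ((n + 1 : ℕ) : ℝ≥0∞)⁻¹ := by
      intro n
      have hsub : {x : E → unitInterval | ¬ x e ≠ x f} ⊆
          ⋃ j ∈ Finset.range (n + 2),
            {x | ∀ g ∈ ({e, f} : Finset E), x g ∈ labelBox (n + 1) j} := by
        intro x hx
        have hx' : x e = x f := not_not.1 hx
        have hm : x e ∈ labelBox (n + 1) _ := rfl
        refine Set.mem_biUnion (Finset.mem_coe.2 (Finset.mem_range.2
          (Nat.lt_succ_of_le (mem_labelBox_le hm)))) ?_
        intro g hg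
        rcases Finset.mem_insert.1 hg with rfl | hg
        · exact hm
        · rw [Finset.mem_singleton.1 hg, ← hx']
          exact hm
      refine (measure_mono hsub).trans ((measure_biUnion_finset_le _ _).trans ?_)
      refine (Finset.sum_le_card_nsmul _ _ _ fun j _ =>
        infinitePi_labelBox_le n.succ_pos j _).trans ?_
      rw [Finset.card_pair hef, Finset.card_range, nsmul_eq_mul, pow_two, ← mul_assoc]
      refine mul_le_mul_left ?_ _
      rw [← div_eq_mul_inv]
      refine ENNReal.div_le_of_le_mul ?_
      exact_mod_cast (by omega : n + 2 ≤ 2 * (n + 1))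
    rw [ae_iff, ← nonpos_iff_eq_zero]
    have := ENNReal.Tendsto.const_mul (a := 2)
      ((Filter.tendsto_add_atTop_iff_nat 1).2 ENNReal.tendsto_inv_nat_nhds_zero)
      (Or.inr (by simp))
    rw [mul_zero] at this
    exact ge_of_tendsto' this hbound
  have hall : ∀ᵐ x ∂Measure.infinitePi (fun _ : E => (volume : Measure unitInterval)),
      ∀ e f : E, e ≠ f → x e ≠ x f := by
    simp_rw [ae_all_iff]
    exact key
  filter_upwards [hall] with x hx e f h
  by_contra hne
  exact hx e f hne h

/-! ### Decreasing paths -/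

open Classical in
/-- The lists of `k + 1` vertices that start at a given vertex and follow the neighborhoods
`N`. -/
def pathLists {E : Type*} (N : E → Finset E) : ℕ → E → Finset (List E)
  | 0, e => {[e]}
  | k + 1, e => (N e).biUnion fun f => (pathLists N k f).image fun l => e :: l

theorem card_pathLists_le {E : Type*} {N : E → Finset E} {D : ℕ} (hN : ∀ e, (N e).card ≤ D)
    (k : ℕ) (e : E) : (pathLists N k e).card ≤ D ^ k := by
  classical
  induction k generalizing e with
  | zero => simp [pathLists]
  | succ k ih =>
    refine (Finset.card_biUnion_le_card_mul _ _ (D ^ k) fun f _ =>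
      Finset.card_image_le.trans (ih f)).trans ?_
    rw [pow_succ']
    exact Nat.mul_le_mul_right _ (hN e)

theorem map_range_mem_pathLists {E : Type*} {N : E → Finset E} {c : ℕ → E}
    (hc : ∀ i, c (i + 1) ∈ N (c i)) (k : ℕ) :
    (List.range (k + 1)).map c ∈ pathLists N k (c 0) := by
  classical
  induction k generalizing c with
  | zero => simp [pathLists]
  | succ k ih =>
    rw [List.range_succ_eq_map, List.map_cons, List.map_map]
    exact Finset.mem_biUnion.2 ⟨c 1, hc 0, Finset.mem_image.2
      ⟨_, ih (c := c ∘ Nat.succ) fun i => hc (i + 1), rfl⟩⟩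

/-- In a graph whose degrees are bounded by `D`, almost surely no infinite path has all its labels
in a given set of measure less than `1 / D`. -/
theorem ae_not_exists_path_labelBox {E : Type*} {N : E → Finset E} {D M : ℕ}
    (hN : ∀ e, (N e).card ≤ D) (hDM : D < M) (j : ℕ) (e : E) :
    ∀ᵐ x ∂Measure.infinitePi (fun _ : E => (volume : Measure unitInterval)),
      ¬ ∃ c : ℕ → E, c 0 = e ∧ Function.Injective c ∧ (∀ i, c (i + 1) ∈ N (c i)) ∧
        ∀ i, x (c i) ∈ labelBox M j := by
  classical
  have hM : 0 < M := by omega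
  have hM0 : (M : ℝ≥0∞) ≠ 0 := by exact_mod_cast hM.ne'
  -- Union bound: at most `D ^ k` lists, each lying in the box with probability at most `M⁻¹ ^ (k +
  -- 1)`; one factor is dropped.
  have hbound : ∀ k : ℕ, Measure.infinitePi (fun _ : E => (volume : Measure unitInterval))
      {x | ¬ ¬ ∃ c : ℕ → E, c 0 = e ∧ Function.Injective c ∧ (∀ i, c (i + 1) ∈ N (c i)) ∧
        ∀ i, x (c i) ∈ labelBox M j} ≤ ((D : ℝ≥0∞) * (M : ℝ≥0∞)⁻¹) ^ k := by
    intro k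
    -- Only lists without repetition are kept, so that independence yields all `k + 1` factors.
    set Q := (pathLists N k e).filter fun l => l.toFinset.card = k + 1
    have hsub : {x : E → unitInterval | ¬ ¬ ∃ c : ℕ → E, c 0 = e ∧ Function.Injective c ∧
        (∀ i, c (i + 1) ∈ N (c i)) ∧ ∀ i, x (c i) ∈ labelBox M j} ⊆
        ⋃ l ∈ Q, {x | ∀ f ∈ l.toFinset, x f ∈ labelBox M j} := by
      intro x hx
      obtain ⟨c, rfl, hinj, hc, hxc⟩ := not_not.1 hx
      refine Set.mem_biUnion (x := (List.range (k + 1)).map c) (Finset.mem_coe.2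
        (Finset.mem_filter.2 ⟨map_range_mem_pathLists hc k, ?_⟩)) ?_
      · rw [List.toFinset_card_of_nodup (List.nodup_range.map hinj), List.length_map,
          List.length_range]
      · intro f hf
        obtain ⟨i, -, rfl⟩ := List.mem_map.1 (List.mem_toFinset.1 hf)
        exact hxc i
    refine (measure_mono hsub).trans ((measure_biUnion_finset_le _ _).trans ?_)
    refine (Finset.sum_le_card_nsmul _ _ ((M : ℝ≥0∞)⁻¹ ^ k) fun l hl => ?_).trans ?_
    · refine (infinitePi_labelBox_le hM j _).trans ?_
      rw [(Finset.mem_filter.1 hl).2]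
      refine pow_le_pow_right_of_le_one' ?_ k.le_succ
      rw [ENNReal.inv_le_one]
      exact_mod_cast hM
    · rw [nsmul_eq_mul, mul_pow]
      refine mul_le_mul_left ?_ _
      exact_mod_cast (Finset.card_filter_le _ _).trans (card_pathLists_le hN k e)
  rw [ae_iff, ← nonpos_iff_eq_zero]
  refine ge_of_tendsto' (ENNReal.tendsto_pow_atTop_nhds_zero_of_lt_one ?_) hbound
  rw [← div_eq_mul_inv]
  refine ENNReal.div_lt_of_lt_mul' ?_
  rw [mul_one]
  exact_mod_cast hDM

/-- In a graph of bounded degree, almost surely no infinite path has decreasing labels. -/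
theorem ae_wellFounded {E : Type*} [Countable E] {N : E → Finset E} {D : ℕ}
    (hN : ∀ e, (N e).card ≤ D) :
    ∀ᵐ x ∂Measure.infinitePi (fun _ : E => (volume : Measure unitInterval)),
      WellFounded fun f e : E => x f < x e ∧ f ∈ N e := by
  have hall : ∀ᵐ x ∂Measure.infinitePi (fun _ : E => (volume : Measure unitInterval)),
      ∀ (j : ℕ) (e : E), ¬ ∃ c : ℕ → E, c 0 = e ∧ Function.Injective c ∧
        (∀ i, c (i + 1) ∈ N (c i)) ∧ ∀ i, x (c i) ∈ labelBox (D + 1) j := by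
    simp_rw [ae_all_iff]
    exact fun j e => ae_not_exists_path_labelBox hN D.lt_succ_self j e
  filter_upwards [hall] with x hx
  rw [wellFounded_iff_isEmpty_descending_chain]
  refine ⟨fun ⟨c, hc⟩ => ?_⟩
  have hanti : StrictAnti fun i => x (c i) := strictAnti_nat_of_succ_lt fun i => (hc i).1
  -- Along a decreasing chain these integer parts are nonincreasing naturals, hence eventually
  -- constant: a tail of the chain lies in a single box.
  have hfloor : Antitone fun i => ⌊((D + 1 : ℕ) : ℝ) * x (c i)⌋₊ := fun i k hik =>
    Nat.floor_le_floor (mul_le_mul_of_nonneg_left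
      (Subtype.coe_le_coe.2 (hanti.antitone hik)) (Nat.cast_nonneg _))
  obtain ⟨m, hm⟩ : ∃ m, ∀ i, ⌊((D + 1 : ℕ) : ℝ) * x (c m)⌋₊ ≤ ⌊((D + 1 : ℕ) : ℝ) * x (c i)⌋₊ :=
    ⟨_, fun i => Function.argmin_le (fun i => ⌊((D + 1 : ℕ) : ℝ) * x (c i)⌋₊) i⟩
  refine hx ⌊((D + 1 : ℕ) : ℝ) * x (c m)⌋₊ (c m) ⟨fun i => c (m + i), rfl, fun i k hik => ?_, fun i => (hc (m + i)).2, fun i => ?_⟩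
  · exact Nat.add_left_cancel (hanti.injective (congrArg x hik))
  · exact le_antisymm (hfloor (Nat.le_add_right m i)) (hm _)

/-! ### Measurability and invariance -/


instance CayleyEdge.instCountable [Countable Γ] : Countable (CayleyEdge S) :=
  inferInstanceAs (Countable {e : Sym2 Γ // e ∈ cayleyEdgeSet S})

instance iidMeasure.instIsProbabilityMeasure : IsProbabilityMeasure (iidMeasure S) :=
  inferInstanceAs (IsProbabilityMeasure (Measure.infinitePi _))

theorem EdgeLabelling.measurable_smul {A : Type*} [MeasurableSpace A] (g : Γ) :
    Measurable fun x : EdgeLabelling S A => g • x :=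
  measurable_pi_iff.2 fun e => measurable_pi_apply (g⁻¹ • e)

/-- The action permutes coordinates whose laws are all equal; finite-dimensional boxes suffice. -/
theorem iidMeasure_map_smul (g : Γ) :
    (iidMeasure S).map (fun x => g • x) = iidMeasure S := by
  classical
  refine Measure.eq_infinitePi _ fun s t ht => ?_
  rw [Measure.map_apply (EdgeLabelling.measurable_smul g)
    (MeasurableSet.pi s.countable_toSet fun i _ => ht i)]
  have : (fun x : EdgeLabelling S unitInterval => g • x) ⁻¹' (s : Set (CayleyEdge S)).pi t =
      ((s.image fun e => g⁻¹ • e : Finset (CayleyEdge S)) : Set (CayleyEdge S)).pi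
        fun e => t (g • e) := by
    ext x
    simp only [Set.mem_preimage, Set.mem_pi, Finset.mem_coe, Finset.mem_image,
      forall_exists_index, and_imp, forall_apply_eq_imp_iff₂, smul_inv_smul]
    rfl
  rw [this, iidMeasure, Measure.infinitePi_pi _ fun i _ => ht _,
    Finset.prod_image fun e _ f _ h => MulAction.injective g⁻¹ h]
  simp only [smul_inv_smul]

theorem measurableSet_mem_edges (e : Sym2 Γ) :
    MeasurableSet {y : SpanningSubgraph S | e ∈ SpanningSubgraph.edges y} := by
  by_cases h : e ∈ cayleyEdgeSet S
  · have : {y : SpanningSubgraph S | e ∈ SpanningSubgraph.edges y} =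
        (fun y => y (⟨e, h⟩ : CayleyEdge S)) ⁻¹' {true} := by
      ext y
      exact SpanningSubgraph.coe_mem_edges_iff (e := ⟨e, h⟩)
    rw [this]
    exact measurable_pi_apply _ (measurableSet_singleton _)
  · have : {y : SpanningSubgraph S | e ∈ SpanningSubgraph.edges y} = ∅ :=
      Set.eq_empty_of_forall_notMem fun y hy => h hy.1
    rw [this]
    exact MeasurableSet.empty

theorem measurableSet_isForest [Countable Γ] :
    MeasurableSet {y : SpanningSubgraph S | SpanningSubgraph.IsForest y} := by
  simp only [SpanningSubgraph.IsForest, isAcyclic_fromEdgeSet_iff, Set.ofPred_forall]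
  refine MeasurableSet.iInter fun u => MeasurableSet.iInter fun v => ?_
  have hm := measurableSet_mem_edges (S := S) s(u, v)
  have hn : ∀ n, MeasurableSet {y : SpanningSubgraph S |
      WithinDist (SpanningSubgraph.edges y \ {s(u, v)}) n u v} := fun n =>
    WithinDist.measurableSet (fun e => (measurableSet_mem_edges e).inter
      (MeasurableSet.const (e ∉ ({s(u, v)} : Set (Sym2 Γ))))) n u v
  convert hm.compl.union (MeasurableSet.iInter fun n => (hn n).compl) using 1
  ext y
  simp [imp_iff_not_or]

theorem measurableSet_isRedundant [Countable Γ] (a : Γ) (n : ℕ) (e : CayleyEdge S) :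
    MeasurableSet {x | IsRedundant a n x e} := by
  have hl : ∀ f, MeasurableSet {x : EdgeLabelling S unitInterval |
      f ∈ lowerEdges a x (x e)} := by
    intro f
    by_cases h : f ∈ cayleyEdgeSet S
    · have hlt : MeasurableSet {x : EdgeLabelling S unitInterval |
          x (⟨f, h⟩ : CayleyEdge S) < x e} :=
        measurableSet_lt (measurable_pi_apply _) (measurable_pi_apply _)
      convert (MeasurableSet.const (f ∈ lineEdges a)).union hlt using 1
      ext x
      exact or_congr Iff.rfl ⟨fun ⟨_, hlt⟩ => hlt, fun hlt => ⟨h, hlt⟩⟩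
    · convert MeasurableSet.const (f ∈ lineEdges a) using 1
      ext x
      exact or_iff_left fun hx => h hx.1
  have : {x | IsRedundant a n x e} = {_x | e.1 ∉ lineEdges a} ∩
      ⋃ u, ⋃ v, {_x | e.1 = s(u, v)} ∩ {x | WithinDist (lowerEdges a x (x e)) n u v} := by
    ext x
    simp only [Set.mem_inter_iff, Set.mem_iUnion]
    rfl
  rw [this]
  exact (MeasurableSet.const _).inter (MeasurableSet.iUnion fun u => MeasurableSet.iUnion fun v =>
    (MeasurableSet.const _).inter (WithinDist.measurableSet hl n u v))

theorem measurable_truncatedForest [Countable Γ] (a : Γ) (n : ℕ) :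
    Measurable (truncatedForest (S := S) a n) := by
  refine measurable_pi_iff.2 fun e => measurable_to_bool ?_
  convert (measurableSet_isRedundant a n e).compl using 1
  ext x
  exact truncatedForest_eq_true_iff

theorem measurable_relativeForest [Countable Γ] (a : Γ) :
    Measurable (relativeForest (S := S) a) := by
  refine measurable_pi_iff.2 fun e => measurable_to_bool ?_
  convert MeasurableSet.iInter fun n => (measurableSet_isRedundant a n e).compl using 1
  ext x
  rw [Set.mem_iInter]
  exact relativeForest_eq_true_iff

/-! ### The expected degree and the cost -/

/-- As `S` is finite, the candidate edges at `1` form a finite set independent of the subgraph.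
Expected degrees thus become finite sums of edge probabilities, which pass to limits. -/
theorem expectedDegree_eq_sum (hS : ∀ s ∈ S, s⁻¹ ∈ S) :
    ∃ T : Finset (CayleyEdge S), ∀ y : SpanningSubgraph S,
      (({e ∈ SpanningSubgraph.edges y | (1 : Γ) ∈ e}.encard : ℕ∞) : ℝ≥0∞) =
        ∑ e ∈ T, {z : SpanningSubgraph S | z e = true}.indicator 1 y := by
  classical
  have hfin : {e : CayleyEdge S | (1 : Γ) ∈ e.1}.Finite := by
    refine ((S.finite_toSet.image fun s => s((1 : Γ), s)).preimage
      Subtype.val_injective.injOn).subset fun e he => ?_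
    obtain ⟨v, hv⟩ := Sym2.mem_iff_exists.1 he
    obtain ⟨s, hs, rfl⟩ := eq_mul_of_mem_cayleyEdgeSet hS (hv ▸ e.2)
    exact ⟨s, hs, by rw [hv, mul_one]⟩
  refine ⟨hfin.toFinset, fun y => ?_⟩
  have : {e ∈ SpanningSubgraph.edges y | (1 : Γ) ∈ e} =
      (fun e : CayleyEdge S => e.1) '' ((hfin.toFinset.filter fun e => y e = true :
        Finset (CayleyEdge S)) : Set (CayleyEdge S)) := by
    ext e
    constructor
    · rintro ⟨⟨hE, hy⟩, h1⟩
      exact ⟨⟨e, hE⟩, Finset.mem_coe.2 (Finset.mem_filter.2 ⟨hfin.mem_toFinset.2 h1, hy⟩), rfl⟩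
    · rintro ⟨e, he, rfl⟩
      obtain ⟨h1, hy⟩ := Finset.mem_filter.1 (Finset.mem_coe.1 he)
      exact ⟨SpanningSubgraph.coe_mem_edges_iff.2 hy, hfin.mem_toFinset.1 h1⟩
  have hinj : Function.Injective fun e : CayleyEdge S => e.1 := Subtype.val_injective
  rw [this, hinj.injOn.encard_image, Set.encard_coe_eq_coe_finsetCard,
    Finset.card_filter]
  simp [Set.indicator_apply]

/-- The graph on `X` in which `x` is joined to `g • x` if `{1, g}` belongs to `P x`. -/
def orbitGraph {X : Type*} [MulAction Γ X] (P : X → Set (Sym2 Γ))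
    (hP : ∀ (g : Γ) x, P (g • x) = Sym2.map (Equiv.mulRight g) ⁻¹' P x) : SimpleGraph X where
  Adj x y := x ≠ y ∧ ∃ g : Γ, y = g • x ∧ s(1, g) ∈ P x
  symm := ⟨by
    rintro x _ ⟨hne, g, rfl, hg⟩
    refine ⟨hne.symm, g⁻¹, by simp, ?_⟩
    -- By equivariance, `{1, g⁻¹}` at `g • x` is the edge `{g, 1}` at `x`.
    rw [hP, Set.mem_preimage, Sym2.map_mk]
    simpa [Sym2.eq_swap] using hg⟩
  loopless := ⟨fun x h => h.1 rfl⟩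

/-- Equivariance identifies the edge `{w, k}` of `P y` with the edge `{1, k * w⁻¹}` of `P (w • y)`,
so a path from `1` to `g` in `P y` is traced in the orbit from `y` to `g • y`. -/
theorem isGraphing_orbitGraph [Countable Γ] {X : Type*} [MeasurableSpace X] [MeasurableEq X]
    [MulAction Γ X] (hact : ∀ g : Γ, Measurable fun x : X => g • x) (P : X → Set (Sym2 Γ))
    (hP : ∀ (g : Γ) x, P (g • x) = Sym2.map (Equiv.mulRight g) ⁻¹' P x)
    (hmeas : ∀ e, MeasurableSet {x | e ∈ P x})
    (hconn : ∀ x, (SimpleGraph.fromEdgeSet (P x)).Preconnected) :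
    IsGraphing (MulAction.orbitRel Γ X) (orbitGraph P hP) where
  measurableSet_adj := by
    refine MeasurableSet.inter
      (measurableSet_eq_fun measurable_fst measurable_snd).compl ?_
    change MeasurableSet {p : X × X | ∃ g : Γ, p.2 = g • p.1 ∧ s(1, g) ∈ P p.1}
    rw [Set.ofPred_exists]
    exact MeasurableSet.iUnion fun g =>
      (measurableSet_eq_fun measurable_snd ((hact g).comp measurable_fst)).inter
        (measurable_fst (hmeas s(1, g)))
  reachable_iff x y := by
    constructor
    · rintro ⟨w⟩
      induction w with
      | nil => exact (MulAction.orbitRel Γ X).refl _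
      | cons h _ ih =>
        obtain ⟨-, g, rfl, -⟩ := h
        exact (MulAction.orbitRel Γ X).trans ((MulAction.orbitRel Γ X).symm
          (MulAction.orbitRel_apply.2 (MulAction.mem_orbit _ g))) ih
    · intro h
      obtain ⟨g, rfl⟩ := MulAction.orbitRel_apply.1 h
      obtain ⟨n, hn⟩ := WithinDist.exists_iff_reachable.2 (hconn y 1 g)
      have key : ∀ n k, WithinDist (P y) n 1 k → (orbitGraph P hP).Reachable y (k • y) := by
        intro n
        induction n with
        | zero =>
          intro k hk
          rw [← show 1 = k from hk, one_smul]
        | succ n ih =>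
          rintro k ⟨w, hw, rfl | hwk⟩
          · exact ih w hw
          · refine (ih w hw).trans ?_
            -- The action need not be free: an edge may collapse to a point, where no step is
            -- needed.
            by_cases heq : w • y = k • y
            · rw [heq]
            · refine SimpleGraph.Adj.reachable ⟨heq, k * w⁻¹, ?_, ?_⟩
              · rw [smul_smul, inv_mul_cancel_right]
              · rw [hP, Set.mem_preimage, Sym2.map_mk]
                simpa using hwk
      exact (key n g hn).symm

/-- Only an inequality, because stabilizers may identify neighbors and loops are dropped. -/
theorem encard_neighborSet_orbitGraph_le {X : Type*} [MulAction Γ X] (P : X → Set (Sym2 Γ))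
    (hP : ∀ (g : Γ) x, P (g • x) = Sym2.map (Equiv.mulRight g) ⁻¹' P x) (x : X) :
    ((orbitGraph P hP).neighborSet x).encard ≤ {e ∈ P x | (1 : Γ) ∈ e}.encard := by
  have h1 : (orbitGraph P hP).neighborSet x ⊆ (fun g : Γ => g • x) '' {g | s(1, g) ∈ P x} := by
    rintro _ ⟨-, g, rfl, hg⟩
    exact ⟨g, hg, rfl⟩
  have h2 : Function.Injective fun g : Γ => s(1, g) := fun g h hgh => Sym2.congr_right.1 hgh
  refine (Set.encard_le_encard h1).trans ((Set.encard_image_le _ _).trans ?_)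
  rw [← h2.injOn.encard_image]
  refine Set.encard_le_encard ?_
  rintro _ ⟨g, hg, rfl⟩
  exact ⟨hg, Sym2.mem_mk_left _ _⟩

theorem preconnected_cayleyEdgeSet (hgen : Subgroup.closure (S : Set Γ) = ⊤) :
    (SimpleGraph.fromEdgeSet (cayleyEdgeSet S)).Preconnected :=
  preconnected_of_forall_reachable hgen fun s hs u =>
    WithinDist.exists_iff_reachable.1 ⟨1, u, rfl, Or.inr ⟨u, s, hs, rfl⟩⟩

/-- The expected degree of a connected factor of i.i.d. is at least twice the cost. -/
theorem two_mul_actionCost_le [Countable Γ] (hgen : Subgroup.closure (S : Set Γ) = ⊤)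
    {Ψ : EdgeLabelling S unitInterval → SpanningSubgraph S} (hΨ : Measurable Ψ)
    (hequiv : ∀ (g : Γ) x, Ψ (g • x) = g • Ψ x)
    (hconn : ∀ᵐ x ∂iidMeasure S,
      (SimpleGraph.fromEdgeSet (SpanningSubgraph.edges (Ψ x))).Preconnected) :
    2 * actionCost Γ (iidMeasure S) ≤ ∫⁻ x,
      (({e ∈ SpanningSubgraph.edges (Ψ x) | (1 : Γ) ∈ e}.encard : ℕ∞) : ℝ≥0∞)
        ∂iidMeasure S := by
  set C : EdgeLabelling S unitInterval → Prop := fun x => ∀ u v, ∃ n,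
    WithinDist (SpanningSubgraph.edges (Ψ x)) n u v with hC
  have hmem : ∀ e, MeasurableSet {x | e ∈ SpanningSubgraph.edges (Ψ x)} := fun e =>
    hΨ (measurableSet_mem_edges e)
  have hCmeas : MeasurableSet {x | C x} := by
    simp only [hC, Set.ofPred_forall, Set.ofPred_exists]
    exact MeasurableSet.iInter fun u => MeasurableSet.iInter fun v => MeasurableSet.iUnion fun n =>
      WithinDist.measurableSet hmem n u v
  have hCsmul : ∀ (g : Γ) x, C (g • x) ↔ C x := by
    intro g x
    simp only [hC, hequiv, SpanningSubgraph.edges_smul, WithinDist.preimage_iff]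
    rw [(Equiv.mulRight g).forall_congr_left]
    refine forall_congr' fun u => ?_
    rw [(Equiv.mulRight g).forall_congr_left]
    simp
  -- A graphing must be right at every point, while connectedness holds almost surely. On the
  -- invariant measurable null set where it fails, the whole Cayley graph is used instead, at no
  -- cost.
  set P : EdgeLabelling S unitInterval → Set (Sym2 Γ) := fun x =>
    {e | e ∈ cayleyEdgeSet S ∧ (C x → e ∈ SpanningSubgraph.edges (Ψ x))} with hPdef
  have hP : ∀ (g : Γ) x, P (g • x) = Sym2.map (Equiv.mulRight g) ⁻¹' P x := by
    intro g x
    ext e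
    simp only [hPdef, Set.mem_ofPred_eq, Set.mem_preimage, hCsmul, map_mem_cayleyEdgeSet_iff,
      hequiv, SpanningSubgraph.edges_smul]
  have hPmeas : ∀ e, MeasurableSet {x | e ∈ P x} := by
    intro e
    convert (MeasurableSet.const (e ∈ cayleyEdgeSet S)).inter (hCmeas.compl.union (hmem e)) using 1
    ext x
    simp only [hPdef, Set.mem_ofPred_eq, Set.mem_inter_iff, Set.mem_union, Set.mem_compl_iff,
      imp_iff_not_or]
  have hPC : ∀ x, C x → P x = SpanningSubgraph.edges (Ψ x) := fun x hx =>
    Set.Subset.antisymm (fun e he => he.2 hx) fun e he => ⟨he.1, fun _ => he⟩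
  have hPconn : ∀ x, (SimpleGraph.fromEdgeSet (P x)).Preconnected := by
    intro x
    by_cases hx : C x
    · rw [hPC x hx]
      exact fun u v => WithinDist.exists_iff_reachable.1 (hx u v)
    · have : P x = cayleyEdgeSet S :=
        Set.Subset.antisymm (fun e he => he.1) fun e he => ⟨he, fun h => absurd h hx⟩
      rw [this]
      exact preconnected_cayleyEdgeSet hgen
  have hG := isGraphing_orbitGraph (EdgeLabelling.measurable_smul (S := S)) P hP hPmeas hPconn
  calc 2 * actionCost Γ (iidMeasure S)
      ≤ 2 * graphCost (iidMeasure S) (orbitGraph P hP) :=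
        mul_le_mul_right (iInf₂_le _ hG) 2
    _ = ∫⁻ x, (((orbitGraph P hP).neighborSet x).encard : ℝ≥0∞) ∂iidMeasure S :=
        ENNReal.mul_div_cancel two_ne_zero ENNReal.ofNat_ne_top
    _ ≤ _ := by
        refine lintegral_mono_ae ?_
        filter_upwards [hconn] with x hx
        have hx' : C x := fun u v => WithinDist.exists_iff_reachable.2 (hx u v)
        rw [← hPC x hx']
        exact ENat.toENNReal_le.2 (encard_neighborSet_orbitGraph_le P hP x)

/-- The bound holds for each truncation, which is almost surely connected. Each edge probability for
the forest is the limit of those for the truncations, by continuity from above. -/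
theorem two_mul_actionCost_le_expectedDegree_relativeForest [Countable Γ] {a : Γ} (haS : a ∈ S)
    (hS : ∀ s ∈ S, s⁻¹ ∈ S) (hgen : Subgroup.closure (S : Set Γ) = ⊤) :
    2 * actionCost Γ (iidMeasure S) ≤
      expectedDegree ((iidMeasure S).map (relativeForest a)) := by
  obtain ⟨T, hT⟩ := expectedDegree_eq_sum hS
  have hset : ∀ e : CayleyEdge S, MeasurableSet {z : SpanningSubgraph S | z e = true} := by
    intro e
    have : Measurable fun z : SpanningSubgraph S => z e := measurable_pi_apply e
    exact this (measurableSet_singleton true)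
  have hsum : ∀ Ψ : EdgeLabelling S unitInterval → SpanningSubgraph S, Measurable Ψ →
      ∫⁻ x, (({e ∈ SpanningSubgraph.edges (Ψ x) | (1 : Γ) ∈ e}.encard : ℕ∞) : ℝ≥0∞)
        ∂iidMeasure S = ∑ e ∈ T, iidMeasure S {x | Ψ x e = true} := by
    intro Ψ hΨ
    simp_rw [hT]
    refine (lintegral_finsetSum _ fun e _ =>
      (measurable_one.indicator (hset e)).comp hΨ).trans ?_
    refine Finset.sum_congr rfl fun e _ => ?_
    exact lintegral_indicator_one (hΨ (hset e))
  have hdeg : expectedDegree ((iidMeasure S).map (relativeForest a)) =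
      ∑ e ∈ T, iidMeasure S {x | relativeForest a x e = true} := by
    rw [← hsum _ (measurable_relativeForest a)]
    refine lintegral_map ?_ (measurable_relativeForest a)
    simp_rw [hT]
    exact Finset.measurable_sum _ fun e _ => measurable_one.indicator (hset e)
  rw [hdeg]
  have hlim : Filter.Tendsto
      (fun n => ∑ e ∈ T, iidMeasure S {x | truncatedForest a n x e = true}) Filter.atTop
      (nhds (∑ e ∈ T, iidMeasure S {x | relativeForest a x e = true})) := by
    refine tendsto_finsetSum _ fun e _ => ?_
    have hinter : {x | relativeForest a x e = true} =
        ⋂ n, {x | truncatedForest a n x e = true} := by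
      ext x
      simp only [Set.mem_iInter, Set.mem_ofPred_eq, relativeForest_eq_true_iff,
        truncatedForest_eq_true_iff]
    rw [hinter]
    refine tendsto_measure_iInter_atTop
      (fun n => (measurable_truncatedForest a n (hset e)).nullMeasurableSet) ?_
      ⟨0, measure_ne_top _ _⟩
    intro m n hmn x hx
    exact truncatedForest_eq_true_iff.2 fun h =>
      truncatedForest_eq_true_iff.1 (show truncatedForest a n x e = true from hx) (h.mono hmn)
  refine ge_of_tendsto' hlim fun n => ?_
  rw [← hsum _ (measurable_truncatedForest a n)]
  refine two_mul_actionCost_le hgen (measurable_truncatedForest a n)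
    (truncatedForest_smul a n) ?_
  filter_upwards [ae_wellFounded (card_nearEdges_le (S := S) n)] with x hx
  exact preconnected_truncatedForest haS hS hgen hx

end

theorem theorem3 {Γ : Type*} [Group Γ] (a : Γ) (ha : ¬ IsOfFinOrder a)
    (S : Finset Γ) (hS_symm : ∀ s ∈ S, s⁻¹ ∈ S)
    (hS_gen : Subgroup.closure (S : Set Γ) = ⊤) (haS : a ∈ S) :
    ∃ σ : Measure (SpanningSubgraph S),
      IsRandomSpanningForest σ ∧
      (∀ᵐ x ∂σ, lineEdges a ⊆ SpanningSubgraph.edges x) ∧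
      IsFactorOfIID σ ∧
      2 * actionCost Γ (iidMeasure S) ≤ expectedDegree σ := by
  have := countable_of_closure_eq_top hS_gen
  have hF := measurable_relativeForest (S := S) a
  refine ⟨(iidMeasure S).map (relativeForest a), ⟨Measure.isProbabilityMeasure_map hF.aemeasurable,
    ?_⟩, ?_, ⟨fun g => ?_, relativeForest a, hF, relativeForest_smul a, rfl⟩,
    two_mul_actionCost_le_expectedDegree_relativeForest haS hS_symm hS_gen⟩
  · rw [ae_map_iff hF.aemeasurable measurableSet_isForest]
    filter_upwards [ae_injective_infinitePi (E := CayleyEdge S)] with x hx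
    exact isForest_relativeForest ha hx
  · have hm : MeasurableSet {y : SpanningSubgraph S |
        lineEdges a ⊆ SpanningSubgraph.edges y} := by
      simp only [Set.subset_def, Set.ofPred_forall]
      exact MeasurableSet.iInter fun e => MeasurableSet.iInter fun _ => measurableSet_mem_edges e
    rw [ae_map_iff hF.aemeasurable hm]
    exact Filter.Eventually.of_forall fun x => lineEdges_subset_relativeForest haS x
  · have hcomm : (fun y : SpanningSubgraph S => g • y) ∘ relativeForest a =
        relativeForest a ∘ fun x => g • x :=
      funext fun x => (relativeForest_smul a g x).symm
    rw [Measure.map_map (EdgeLabelling.measurable_smul g) hF, hcomm,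
      ← Measure.map_map hF (EdgeLabelling.measurable_smul g), iidMeasure_map_smul]
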